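/- Let $d\ge 1$ and equip $\mathbb{R}^{d+1}$ with the sup-norm $\|\cdot\|_\infty$. Let $\phi:\mathbb{R}\to\mathbb{R}$ be continuous and not a polynomial, and suppose that $|\phi(x)|\le C_1|x|^\alpha+C_2$ for all $x\in\mathbb{R}$, for some constants $\alpha,C_1,C_2\ge 0$. Let $\mu$ be a probability distribution with full support on $\mathbb{R}^{d+1}$ such that $\int \|(w,b)\|_\infty^\alpha\,d\mu(w,b)<\infty$, where $w\in\mathbb{R}^d$ and $b\in\mathbb{R}$. Then the pair $(\phi,\mu)$ is universal, that is: for every compact set $\mathcal{X}\subseteq\mathbb{R}^d$, every continuous function $f:\mathcal{X}\to\mathbb{R}$ and all $\epsilon,\delta\in(0,1)$, there exists an integer $n\ge 1$ such that, if $(w_i,b_i)_{i\ge1}$ is any sequence of i.i.d. random vectors with distribution $\mu$, then with probability at least $1-\delta$ there exist $a_1,\dots,a_n\in\mathbb{R}$ (which may depend on $(w_i,b_i)_{1\le i\le n}$) with $$\sup_{x\in\mathcal{X}}\Big|f(x)-\sum_{i=1}^n a_i\,\phi(w_i\cdot x+b_i)\Big|\le\epsilon .$$ -/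

import Mathlib

universe u

open MeasureTheory ProbabilityTheory

/-- Response `φ (w ⬝ x + b)` of a single neuron with weight vector `v = (w, b) ∈ ℝ^(d+1)`:
`w` consists of the first `d` coordinates of `v` and the bias `b` is the last coordinate. -/
def neuron (φ : ℝ → ℝ) {d : ℕ} (v : Fin (d + 1) → ℝ) (x : Fin d → ℝ) : ℝ :=
  φ ((∑ j : Fin d, v (Fin.castSucc j) * x j) + v (Fin.last d))

/-- The one-hidden-layer network `x ↦ ∑ i, a i * φ (w i ⬝ x + b i)` with `n` neurons, internal
weights `v i = (w i, b i)` and readout weights `a`. -/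
def network (φ : ℝ → ℝ) {d n : ℕ} (a : Fin n → ℝ) (v : Fin n → Fin (d + 1) → ℝ)
    (x : Fin d → ℝ) : ℝ :=
  ∑ i : Fin n, a i * neuron φ (v i) x

/-- `W 0, W 1, …` are independent random vectors on the probability space `(Ω, P)`,
each with distribution `μ`. -/
structure IsIIDSample {Ω : Type*} [MeasurableSpace Ω] {d : ℕ}
    (W : ℕ → Ω → (Fin (d + 1) → ℝ)) (μ : Measure (Fin (d + 1) → ℝ)) (P : Measure Ω) :
    Prop where
  indep : iIndepFun W P
  law : ∀ i, HasLaw (W i) μ P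

/-- The pair `(φ, μ)` is universal: for every compact `X ⊆ ℝ^d`, every continuous `f : X → ℝ` and
all `ε, δ ∈ (0, 1)` there is a width `n ≥ 1` such that, for every i.i.d. sequence of internal
weights drawn from `μ`, with probability at least `1 - δ` some readout weights (which may depend
on the sample) give `|f x - ∑ i, a i * φ (w i ⬝ x + b i)| ≤ ε` for all `x ∈ X`.
"With probability at least `1 - δ`" means that this happens at every point of a measurable event
`A` of probability at least `1 - δ`. -/
def IsUniversalPair (φ : ℝ → ℝ) {d : ℕ} (μ : Measure (Fin (d + 1) → ℝ)) : Prop :=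
  ∀ X : Set (Fin d → ℝ), IsCompact X →
  ∀ f : (Fin d → ℝ) → ℝ, ContinuousOn f X →
  ∀ ε ∈ Set.Ioo (0 : ℝ) 1, ∀ δ ∈ Set.Ioo (0 : ℝ) 1,
  ∃ n : ℕ, 1 ≤ n ∧
    ∀ (Ω : Type u) [MeasurableSpace Ω] (P : Measure Ω) [IsProbabilityMeasure P]
      (W : ℕ → Ω → (Fin (d + 1) → ℝ)), IsIIDSample W μ P →
      ∃ A : Set Ω, MeasurableSet A ∧ ENNReal.ofReal (1 - δ) ≤ P A ∧
        ∀ ω ∈ A, ∃ a : Fin n → ℝ, ∀ x ∈ X,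
          |f x - network φ a (fun i : Fin n => W i ω) x| ≤ ε

open Filter Topology
open scoped Convolution ContDiff

/-! Density comes first, sampling second. Let `V` be the closed span of the neurons in `C(X, ℝ)`.
For linear `g`, `V` contains every `φ (a g + b)`. Mollifying `φ` in `b` stays in `V`, and
differentiating the smooth result `k` times in `a` at `a = 0` gives its `k`-th derivative at `b`
times `g ^ k`. If `g ^ k ∉ V`, that derivative vanishes identically, so every mollification is a
polynomial of degree `< k`, and so is their limit `φ`, a contradiction
(`Submodule.pow_mem_of_affineComp_mem`). Hence `V` contains `exp g`, and Stone–Weierstrass gives `V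
= ⊤`.

A finite approximating network tolerates small changes of its internal weights. By full support,
each of its finitely many neighbourhoods is hit by a large sample with probability near 1; unneeded
neurons get weight zero. -/

/-- A closed submodule contains the integrals of its integrable functions. -/
theorem Submodule.integral_mem_of_isClosed {T E : Type*} [MeasurableSpace T] {ν : Measure T}
    [NormedAddCommGroup E] [NormedSpace ℝ E] [CompleteSpace E] {V : Submodule ℝ E}
    (hV : IsClosed (V : Set E)) {F : T → E} (hF : Integrable F ν) (hmem : ∀ t, F t ∈ V) :
    ∫ t, F t ∂ν ∈ V := by
  by_contra h
  obtain ⟨f, u, hu, hfu⟩ := geometric_hahn_banach_closed_point V.convex hV h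
  have hu0 : 0 < u := by simpa using hu 0 V.zero_mem
  have hzero : ∀ v ∈ V, f v = 0 := by
    intro v hv
    by_contra hne
    -- Rescaling `v` makes `f` attain the bound `u`, which it must stay strictly below on `V`.
    have := hu ((u / f v) • v) (V.smul_mem _ hv)
    rw [map_smul, smul_eq_mul, div_mul_cancel₀ _ hne] at this
    exact lt_irrefl _ this
  have : f (∫ t, F t ∂ν) = 0 := by
    rw [← f.integral_comp_comm hF]
    simp [hzero _ (hmem _)]
  linarith

/-- A differentiable curve lying in a closed submodule has its derivatives in it. -/
theorem Submodule.hasDerivAt_mem_of_isClosed {E : Type*} [NormedAddCommGroup E]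
    [NormedSpace ℝ E] {V : Submodule ℝ E} (hV : IsClosed (V : Set E)) {F : ℝ → E} {F' : E} {a : ℝ}
    (hF : HasDerivAt F F' a) (hmem : ∀ t, F t ∈ V) : F' ∈ V := by
  refine hV.mem_of_tendsto hF.tendsto_slope (Eventually.of_forall fun t => ?_)
  exact V.smul_mem _ (V.sub_mem (hmem _) (hmem _))

theorem exists_polynomial_of_iteratedDeriv_eq_zero (k : ℕ) {σ : ℝ → ℝ} (hσ : ContDiff ℝ ∞ σ)
    (h : ∀ x, iteratedDeriv k σ x = 0) :
    ∃ p : Polynomial ℝ, p.degree < k ∧ ∀ x, σ x = p.eval x := by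
  induction k generalizing σ with
  | zero => exact ⟨0, by simp, fun x => by simpa using h x⟩
  | succ k ih =>
    have hd := contDiff_infty_iff_deriv.1 hσ
    obtain ⟨p, hp, hpe⟩ := ih hd.2 fun x => by rw [← iteratedDeriv_succ']; exact h x
    let q : Polynomial ℝ :=
      ∑ i ∈ Finset.range k, Polynomial.monomial (i + 1) (p.coeff i / (i + 1))
    have hq : q.derivative = p := by
      have : p = ∑ i ∈ Finset.range k, Polynomial.monomial i (p.coeff i) := by
        ext n
        simp only [Polynomial.finsetSum_coeff, Polynomial.coeff_monomial]
        rw [Finset.sum_ite_eq' (Finset.range k) n]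
        split_ifs with hn
        · rfl
        · exact Polynomial.coeff_eq_zero_of_degree_lt (hp.trans_le (by simpa using hn))
      conv_rhs => rw [this]
      simp only [q, Polynomial.derivative_sum, Polynomial.derivative_monomial]
      refine Finset.sum_congr rfl fun i _ => ?_
      congr 1
      push_cast
      field_simp
    have hqd : q.degree < (k + 1 : ℕ) := by
      refine (Polynomial.degree_sum_le _ _).trans_lt ?_
      rw [Finset.sup_lt_iff (by exact_mod_cast WithBot.bot_lt_coe _)]
      intro i hi
      refine (Polynomial.degree_monomial_le _ _).trans_lt ?_
      have := Finset.mem_range.1 hi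
      exact_mod_cast Nat.succ_lt_succ this
    have hconst : ∀ x, σ x - q.eval x = σ 0 - q.eval 0 := by
      intro x
      refine is_const_of_deriv_eq_zero (f := fun x => σ x - q.eval x)
        (hd.1.sub q.differentiable) (fun y => ?_) x 0
      rw [deriv_fun_sub (hd.1 y) q.differentiableAt, Polynomial.deriv, hq, hpe, sub_self]
    refine ⟨q + Polynomial.C (σ 0 - q.eval 0), ?_, fun x => ?_⟩
    · refine (Polynomial.degree_add_le _ _).trans_lt (max_lt hqd ?_)
      refine Polynomial.degree_C_le.trans_lt ?_
      exact_mod_cast Nat.succ_pos k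
    · simp [← hconst x]

/-- A pointwise limit of polynomials of bounded degree is a polynomial. -/
theorem exists_polynomial_of_tendsto {ι : Type*} {l : Filter ι} [l.NeBot] {k : ℕ}
    {p : ι → Polynomial ℝ} (hp : ∀ i, (p i).degree < k) {φ : ℝ → ℝ}
    (h : ∀ x, Tendsto (fun i => (p i).eval x) l (𝓝 (φ x))) :
    ∃ q : Polynomial ℝ, ∀ x, φ x = q.eval x := by
  have hinj : Set.InjOn (fun j : ℕ => (j : ℝ)) (Finset.range k : Finset ℕ) :=
    Nat.cast_injective.injOn
  refine ⟨Lagrange.interpolate (Finset.range k) (fun j : ℕ => (j : ℝ)) (fun j => φ j),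
    fun x => ?_⟩
  refine tendsto_nhds_unique (h x) ?_
  have heq : ∀ i, (p i).eval x = ∑ j ∈ Finset.range k, (p i).eval (j : ℝ) *
      (Lagrange.basis (Finset.range k) (fun j : ℕ => (j : ℝ)) j).eval x := by
    intro i
    conv_lhs => rw [Lagrange.eq_interpolate (f := p i) hinj (by simpa using hp i)]
    simp [Lagrange.interpolate_apply, Polynomial.eval_finsetSum]
  simp only [heq, Lagrange.interpolate_apply, Polynomial.eval_finsetSum, Polynomial.eval_mul,
    Polynomial.eval_C]
  exact tendsto_finsetSum _ fun j _ => (h j).mul_const _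

/-! ### Powers of `g` from superpositions `φ (a g + b)` -/

section Superposition

variable {X : Type*} [TopologicalSpace X]

/-- The function `x ↦ σ (a * g x + b)` as an element of `C(X, ℝ)`. -/
def ContinuousMap.affineComp (σ : C(ℝ, ℝ)) (g : C(X, ℝ)) (a b : ℝ) : C(X, ℝ) :=
  ⟨fun x => σ (a * g x + b), by fun_prop⟩

theorem ContinuousMap.continuous_affineComp (σ : C(ℝ, ℝ)) (g : C(X, ℝ)) :
    Continuous fun p : ℝ × ℝ => σ.affineComp g p.1 p.2 := by
  refine ContinuousMap.continuous_of_continuous_uncurry _ ?_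
  simp only [Function.uncurry_def, affineComp, ContinuousMap.coe_mk]
  fun_prop

variable [CompactSpace X]

/-- The superposition operator `a ↦ σ (a g + b)` is differentiable in `a`. -/
theorem ContinuousMap.hasDerivAt_affineComp {σ σ' : C(ℝ, ℝ)}
    (hσ : ∀ t, HasDerivAt σ (σ' t) t) (g : C(X, ℝ)) (a b : ℝ) :
    HasDerivAt (fun a => σ.affineComp g a b) (g * σ'.affineComp g a b) a := by
  have hcont : Continuous fun s : ℝ => g * σ'.affineComp g s b :=
    continuous_const.mul ((σ'.continuous_affineComp g).comp (by fun_prop : Continuous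
      fun s : ℝ => (s, b)))
  -- Writing the curve as a `C(X, ℝ)`-valued integral turns pointwise differentiability into
  -- differentiability in sup norm.
  have hint : (fun a => σ.affineComp g a b) =
      fun a => σ.affineComp g 0 b + ∫ s in (0 : ℝ)..a, g * σ'.affineComp g s b := by
    funext a
    ext x
    have hx : (∫ s in (0 : ℝ)..a, g * σ'.affineComp g s b) x =
        ∫ s in (0 : ℝ)..a, g x * σ' (s * g x + b) :=
      ((ContinuousMap.evalCLM ℝ x).intervalIntegral_comp_comm
        (hcont.intervalIntegrable 0 a)).symm
    rw [ContinuousMap.add_apply, hx, intervalIntegral.integral_eq_sub_of_hasDerivAt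
      (f := fun s => σ (s * g x + b))]
    · simp [affineComp]
    · intro s _
      have := (hσ (s * g x + b)).comp s (((hasDerivAt_id s).mul_const (g x)).add_const b)
      rw [one_mul, mul_comm] at this
      exact this
    · exact Continuous.intervalIntegrable (by fun_prop) _ _
  rw [hint]
  exact (intervalIntegral.integral_hasDerivAt_right (hcont.intervalIntegrable 0 a)
    (hcont.stronglyMeasurableAtFilter _ _) hcont.continuousAt).const_add _

/-- Each derivative in `a` brings down one factor `g`, and difference quotients stay in `V`. -/
theorem Submodule.pow_mul_affineComp_mem {V : Submodule ℝ C(X, ℝ)}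
    (hV : IsClosed (V : Set C(X, ℝ))) {σ : ℝ → ℝ} (hσ : ContDiff ℝ ∞ σ) {g : C(X, ℝ)}
    (hmem : ∀ a b, ContinuousMap.affineComp ⟨σ, hσ.continuous⟩ g a b ∈ V) (k : ℕ) (a b : ℝ) :
    g ^ k * ContinuousMap.affineComp
      ⟨iteratedDeriv k σ, hσ.continuous_iteratedDeriv k (by exact_mod_cast le_top)⟩ g a b ∈ V := by
  induction k generalizing a with
  | zero => simpa using hmem a b
  | succ k ih =>
    have hder : ∀ t, HasDerivAt (iteratedDeriv k σ) (iteratedDeriv (k + 1) σ t) t := by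
      intro t
      rw [iteratedDeriv_succ]
      exact ((hσ.differentiable_iteratedDeriv k (by exact_mod_cast WithTop.coe_lt_top k))
        t).hasDerivAt
    have := (ContinuousMap.hasDerivAt_affineComp
      (σ := ⟨iteratedDeriv k σ, hσ.continuous_iteratedDeriv k (by exact_mod_cast le_top)⟩)
      (σ' := ⟨iteratedDeriv (k + 1) σ,
        hσ.continuous_iteratedDeriv (k + 1) (by exact_mod_cast le_top)⟩) hder g a b).const_mul
      (g ^ k)
    rw [← mul_assoc, ← pow_succ] at this
    exact V.hasDerivAt_mem_of_isClosed hV this ih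

/-- Convolving in `b` is a `C(X, ℝ)`-valued integral of translates, each in `V`; this permits
replacing `φ` by a smooth function. -/
theorem Submodule.convolution_affineComp_mem {V : Submodule ℝ C(X, ℝ)}
    (hV : IsClosed (V : Set C(X, ℝ))) {φ : C(ℝ, ℝ)} {g : C(X, ℝ)}
    (hmem : ∀ a b, φ.affineComp g a b ∈ V) {ψ : ℝ → ℝ} (hψ : Continuous ψ)
    (hψc : HasCompactSupport ψ)
    (hcont : Continuous (ψ ⋆[ContinuousLinearMap.lsmul ℝ ℝ, volume] φ)) (a b : ℝ) :
    ContinuousMap.affineComp ⟨_, hcont⟩ g a b ∈ V := by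
  have hF : Continuous fun t : ℝ => ψ t • φ.affineComp g a (b - t) :=
    hψ.smul ((φ.continuous_affineComp g).comp (by fun_prop : Continuous fun t : ℝ => (a, b - t)))
  have hint : Integrable (fun t : ℝ => ψ t • φ.affineComp g a (b - t)) :=
    hF.integrable_of_hasCompactSupport hψc.smul_right
  have heq : ContinuousMap.affineComp ⟨_, hcont⟩ g a b =
      ∫ t : ℝ, ψ t • φ.affineComp g a (b - t) := by
    ext x
    have hx : (∫ t : ℝ, ψ t • φ.affineComp g a (b - t)) x =
        ∫ t : ℝ, ψ t * φ (a * g x + (b - t)) :=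
      ((ContinuousMap.evalCLM ℝ x).integral_comp_comm hint).symm
    rw [hx]
    simp [ContinuousMap.affineComp, convolution_def, add_sub_assoc]
  rw [heq]
  exact V.integral_mem_of_isClosed hV hint fun t => V.smul_mem _ (hmem _ _)

/-- If a closed subspace of `C(X, ℝ)` contains all `φ (a g + b)` for a continuous `φ` that is not
a polynomial, then it contains all powers of `g`. -/
theorem Submodule.pow_mem_of_affineComp_mem {V : Submodule ℝ C(X, ℝ)}
    (hV : IsClosed (V : Set C(X, ℝ))) {φ : C(ℝ, ℝ)}
    (hφ : ¬ ∃ p : Polynomial ℝ, ∀ x, φ x = p.eval x) {g : C(X, ℝ)}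
    (hmem : ∀ a b, φ.affineComp g a b ∈ V) (k : ℕ) : g ^ k ∈ V := by
  by_contra hk
  refine hφ ?_
  let ψ : ℕ → ContDiffBump (0 : ℝ) := fun n =>
    ⟨1 / ((n : ℝ) + 1) / 2, 1 / ((n : ℝ) + 1), by positivity, half_lt_self (by positivity)⟩
  have hsmooth : ∀ n, ContDiff ℝ ∞
      ((ψ n).normed volume ⋆[ContinuousLinearMap.lsmul ℝ ℝ, volume] φ) := fun n =>
    (ψ n).hasCompactSupport_normed.contDiff_convolution_left _ (ψ n).contDiff_normed
      φ.continuous.locallyIntegrable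
  have hpoly : ∀ n, ∃ p : Polynomial ℝ, p.degree < k ∧ ∀ x,
      ((ψ n).normed volume ⋆[ContinuousLinearMap.lsmul ℝ ℝ, volume] φ) x = p.eval x := by
    intro n
    refine exists_polynomial_of_iteratedDeriv_eq_zero k (hsmooth n) fun b => ?_
    by_contra hne
    -- At `a = 0` the second factor is the constant `k`-th derivative at `b`; dividing by it leaves
    -- `g ^ k`.
    have h := V.pow_mul_affineComp_mem hV (hsmooth n)
      (V.convolution_affineComp_mem hV hmem (ψ n).continuous_normed
        (ψ n).hasCompactSupport_normed (hsmooth n).continuous) k 0 b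
    refine hk ?_
    convert V.smul_mem (iteratedDeriv k
      ((ψ n).normed volume ⋆[ContinuousLinearMap.lsmul ℝ ℝ, volume] φ) b)⁻¹ h using 1
    ext x
    simp only [ContinuousMap.affineComp, ContinuousMap.smul_apply, ContinuousMap.mul_apply,
      ContinuousMap.coe_mk, zero_mul, zero_add, smul_eq_mul]
    field_simp
  choose p hp hpe using hpoly
  refine exists_polynomial_of_tendsto (l := atTop) hp fun x => ?_
  simp only [← hpe]
  exact ContDiffBump.convolution_tendsto_right_of_continuous
    (tendsto_one_div_add_atTop_nhds_zero_nat) φ.continuous x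

end Superposition

/-! ### Density of networks in `C(X, ℝ)` -/

section Density

variable {d : ℕ}

/-- The linear functional `x ↦ w ⬝ x` restricted to `X`. -/
def dotOn (X : Set (Fin d → ℝ)) (w : Fin d → ℝ) : C(X, ℝ) :=
  ⟨fun x => ∑ j, w j * x.1 j, continuous_finsetSum _ fun j _ =>
    continuous_const.mul ((continuous_apply j).comp continuous_subtype_val)⟩

theorem Continuous.neuron {Y : Type*} [TopologicalSpace Y] {φ : ℝ → ℝ} (hφ : Continuous φ)
    {v : Y → Fin (d + 1) → ℝ} {x : Y → Fin d → ℝ} (hv : Continuous v) (hx : Continuous x) :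
    Continuous fun y => neuron φ (v y) (x y) :=
  hφ.comp ((continuous_finsetSum _ fun j _ => ((continuous_apply _).comp hv).mul
    ((continuous_apply j).comp hx)).add ((continuous_apply _).comp hv))

/-- The response of a neuron restricted to `X`. -/
def neuronOn (X : Set (Fin d → ℝ)) (φ : C(ℝ, ℝ)) (v : Fin (d + 1) → ℝ) : C(X, ℝ) :=
  ⟨fun x => neuron φ v x, φ.continuous.neuron continuous_const continuous_subtype_val⟩

theorem continuous_neuronOn (X : Set (Fin d → ℝ)) (φ : C(ℝ, ℝ)) :
    Continuous (neuronOn X φ) := by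
  refine ContinuousMap.continuous_of_continuous_uncurry _ ?_
  exact φ.continuous.neuron continuous_fst (continuous_subtype_val.comp continuous_snd)

/-- Exponentials of linear forms are closed under products, so their span is already the algebra
they generate, and Stone–Weierstrass applies. -/
theorem span_exp_dotOn_dense (X : Set (Fin d → ℝ)) [CompactSpace X] :
    (Submodule.span ℝ (Set.range fun w => NormedSpace.exp (dotOn X w))).topologicalClosure = ⊤ := by
  let E : Multiplicative (Fin d → ℝ) →* C(X, ℝ) :=
    { toFun := fun w => NormedSpace.exp (dotOn X w.toAdd)
      map_one' := by
        have : dotOn X (0 : Fin d → ℝ) = 0 := by ext; simp [dotOn]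
        simp [this]
      map_mul' := fun v w => by
        have : dotOn X (v.toAdd + w.toAdd) = dotOn X v.toAdd + dotOn X w.toAdd := by
          ext; simp [dotOn, add_mul, Finset.sum_add_distrib]
        rw [toAdd_mul, this, NormedSpace.exp_add] }
  have hE : (Set.range fun w => NormedSpace.exp (dotOn X w)) = (MonoidHom.mrange E : Set C(X, ℝ)) :=
    rfl
  have heval : ∀ w (x : X), NormedSpace.exp (dotOn X w) x = Real.exp (dotOn X w x) := by
    intro w x
    rw [Real.exp_eq_exp_ℝ]
    exact NormedSpace.map_exp (ContinuousMap.evalAlgHom ℝ ℝ x) 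
      (continuous_eval_const x) _
  have hsep : (Algebra.adjoin ℝ (MonoidHom.mrange E : Set C(X, ℝ))).SeparatesPoints := by
    intro x y hxy
    obtain ⟨j, hj⟩ : ∃ j, x.1 j ≠ y.1 j := by
      by_contra! h
      exact hxy (Subtype.ext (funext h))
    refine ⟨_, ⟨NormedSpace.exp (dotOn X (Pi.single j 1)),
      Algebra.subset_adjoin ⟨Multiplicative.ofAdd (Pi.single j 1), rfl⟩, rfl⟩, ?_⟩
    simp only [heval, ne_eq, Real.exp_eq_exp]
    simpa [dotOn, Pi.single_apply] using hj
  have htop := ContinuousMap.subalgebra_topologicalClosure_eq_top_of_separatesPoints _ hsep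
  rw [hE]
  have hspan := Algebra.adjoin_eq_span ℝ (MonoidHom.mrange E : Set C(X, ℝ))
  rw [Submonoid.closure_eq] at hspan
  rw [← hspan]
  refine SetLike.coe_injective ?_
  exact congrArg (fun A : Subalgebra ℝ C(X, ℝ) => (A : Set C(X, ℝ))) htop

/-- Networks with a continuous non-polynomial activation are dense in `C(X, ℝ)`. -/
theorem span_neuronOn_dense (X : Set (Fin d → ℝ)) [CompactSpace X] {φ : C(ℝ, ℝ)}
    (hφ : ¬ ∃ p : Polynomial ℝ, ∀ x, φ x = p.eval x) :
    (Submodule.span ℝ (Set.range (neuronOn X φ))).topologicalClosure = ⊤ := by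
  set V := (Submodule.span ℝ (Set.range (neuronOn X φ))).topologicalClosure with hVdef
  have hV : IsClosed (V : Set C(X, ℝ)) := Submodule.isClosed_topologicalClosure _
  have hmem : ∀ w a b, φ.affineComp (dotOn X w) a b ∈ V := by
    intro w a b
    refine Submodule.le_topologicalClosure _ (Submodule.subset_span
      ⟨Fin.snoc (α := fun _ => ℝ) (a • w) b, ?_⟩)
    ext x
    simp [neuronOn, neuron, ContinuousMap.affineComp, dotOn, Finset.mul_sum, mul_assoc]
  rw [eq_top_iff, ← span_exp_dotOn_dense X]
  refine Submodule.topologicalClosure_minimal _ (Submodule.span_le.2 ?_) hV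
  rintro _ ⟨w, rfl⟩
  refine hV.mem_of_tendsto (NormedSpace.exp_series_hasSum_exp' (𝕂 := ℝ) (dotOn X w))
    (Eventually.of_forall fun s => V.sum_mem fun k _ => V.smul_mem _ ?_)
  exact V.pow_mem_of_affineComp_mem hV hφ (hmem w) k

/-- A finite network approximating `f` can have each of its neurons perturbed within a
neighbourhood of its internal weights. -/
theorem exists_finset_isOpen_approx {φ : ℝ → ℝ} (hφc : Continuous φ)
    (hφ : ¬ ∃ p : Polynomial ℝ, ∀ x, φ x = p.eval x) {X : Set (Fin d → ℝ)} (hX : IsCompact X)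
    {f : (Fin d → ℝ) → ℝ} (hf : ContinuousOn f X) {ε : ℝ} (hε : 0 < ε) :
    ∃ (s : Finset (Fin (d + 1) → ℝ)) (c : (Fin (d + 1) → ℝ) → ℝ)
      (U : (Fin (d + 1) → ℝ) → Set (Fin (d + 1) → ℝ)),
      (∀ v, IsOpen (U v) ∧ v ∈ U v) ∧
      ∀ v' : (Fin (d + 1) → ℝ) → (Fin (d + 1) → ℝ), (∀ v ∈ s, v' v ∈ U v) →
        ∀ x ∈ X, |f x - ∑ v ∈ s, c v * neuron φ (v' v) x| ≤ ε := by
  have : CompactSpace X := isCompact_iff_compactSpace.1 hX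
  let Φ : C(ℝ, ℝ) := ⟨φ, hφc⟩
  let F : C(X, ℝ) := ⟨X.domRestrict f, hf.domRestrict⟩
  have hF : F ∈ closure (Submodule.span ℝ (Set.range (neuronOn X Φ)) : Set C(X, ℝ)) := by
    rw [← Submodule.topologicalClosure_coe, span_neuronOn_dense X (φ := Φ) hφ]
    trivial
  obtain ⟨h, hh, hdist⟩ := Metric.mem_closure_iff.1 hF (ε / 2) (by positivity)
  obtain ⟨c, rfl⟩ := Finsupp.mem_span_range_iff_exists_finsupp.1 hh
  set B := ∑ v ∈ c.support, |c v| with hB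
  have hB0 : 0 ≤ B := Finset.sum_nonneg fun _ _ => abs_nonneg _
  -- The `+ 1` keeps the denominator positive when all coefficients vanish.
  set η := ε / 2 / (B + 1) with hη
  have hη0 : 0 < η := by positivity
  refine ⟨c.support, c, fun v => neuronOn X Φ ⁻¹' Metric.ball (neuronOn X Φ v) η,
    fun v => ⟨Metric.isOpen_ball.preimage (continuous_neuronOn X Φ), Metric.mem_ball_self hη0⟩,
    fun v' hv' x hx => ?_⟩
  have h1 : |f x - ∑ v ∈ c.support, c v * neuron φ v x| ≤ ε / 2 := by
    have := (ContinuousMap.dist_apply_le_dist (⟨x, hx⟩ : X)).trans hdist.le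
    rw [Real.dist_eq] at this
    rw [Finsupp.sum, ContinuousMap.sum_apply] at this
    exact this
  have h2 : |∑ v ∈ c.support, c v * neuron φ v x - ∑ v ∈ c.support, c v * neuron φ (v' v) x|
      ≤ ε / 2 := by
    rw [← Finset.sum_sub_distrib]
    calc _ ≤ ∑ v ∈ c.support, |c v| * η := by
          refine (Finset.abs_sum_le_sum_abs _ _).trans (Finset.sum_le_sum fun v hv => ?_)
          rw [← mul_sub, abs_mul]
          refine mul_le_mul_of_nonneg_left ?_ (abs_nonneg _)
          have := (ContinuousMap.dist_apply_le_dist (⟨x, hx⟩ : X)).trans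
            (Metric.mem_ball'.1 (hv' v hv)).le
          rwa [Real.dist_eq] at this
      _ = ε / 2 * (B / (B + 1)) := by rw [← Finset.sum_mul, ← hB, hη]; ring
      _ ≤ ε / 2 * 1 := by
          refine mul_le_mul_of_nonneg_left ?_ (by positivity)
          rw [div_le_one (by positivity)]
          linarith
      _ = ε / 2 := mul_one _
  calc _ ≤ _ + _ := abs_sub_le _ (∑ v ∈ c.support, c v * neuron φ v x) _
    _ ≤ ε := by linarith

end Density

/-! ### Random sampling of the internal weights -/

theorem measure_forall_lt_notMem {Ω : Type*} [MeasurableSpace Ω] {P : Measure Ω} {d : ℕ}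
    {W : ℕ → Ω → (Fin (d + 1) → ℝ)} {μ : Measure (Fin (d + 1) → ℝ)} (hW : IsIIDSample W μ P)
    {U : Set (Fin (d + 1) → ℝ)} (hU : MeasurableSet U) (n : ℕ) :
    P (⋂ i ∈ Finset.range n, W i ⁻¹' Uᶜ) = μ Uᶜ ^ n := by
  rw [hW.indep.measure_inter_preimage_eq_mul (Finset.range n) (sets := fun _ => Uᶜ)
    (fun _ _ => hU.compl)]
  have : ∀ i, P (W i ⁻¹' Uᶜ) = μ Uᶜ := fun i => by
    rw [← (hW.law i).map_eq, Measure.map_apply_of_aemeasurable (hW.law i).aemeasurable hU.compl]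
  simp only [this, Finset.prod_const, Finset.card_range]

/-- If each neighbourhood `U v` contains the internal weights of some neuron, the coefficients `c`
can be attached to suitable neurons of the sample. -/
theorem exists_readout {φ : ℝ → ℝ} {d n : ℕ} {s : Finset (Fin (d + 1) → ℝ)}
    (c : (Fin (d + 1) → ℝ) → ℝ) (V : Fin n → (Fin (d + 1) → ℝ)) (i : (Fin (d + 1) → ℝ) → Fin n) :
    ∃ a : Fin n → ℝ, ∀ x, network φ a V x = ∑ v ∈ s, c v * neuron φ (V (i v)) x := by
  -- Several `v` may select the same neuron, so their coefficients add up.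
  refine ⟨fun j => ∑ v ∈ s with i v = j, c v, fun x => ?_⟩
  rw [network, ← Finset.sum_fiberwise s i]
  refine Finset.sum_congr rfl fun j _ => ?_
  rw [Finset.sum_mul]
  refine Finset.sum_congr rfl fun v hv => ?_
  rw [(Finset.mem_filter.1 hv).2]

theorem mainTheorem4 (d : ℕ) (φ : ℝ → ℝ) (hφ_cont : Continuous φ)
    (hφ_poly : ¬ ∃ p : Polynomial ℝ, ∀ x, φ x = p.eval x)
    (α C₁ C₂ : ℝ) (hα : 0 ≤ α) (hC₁ : 0 ≤ C₁) (hC₂ : 0 ≤ C₂)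
    (hφ_growth : ∀ x, |φ x| ≤ C₁ * |x| ^ α + C₂)
    (μ : Measure (Fin (d + 1) → ℝ)) [IsProbabilityMeasure μ]
    (hμ_supp : μ.support = Set.univ)
    (hμ_moment : Integrable (fun v : Fin (d + 1) → ℝ => ‖v‖ ^ α) μ) :
    IsUniversalPair.{u} φ μ := by
  intro X hX f hf ε hε δ hδ
  obtain ⟨s, c, U, hU, happ⟩ := exists_finset_isOpen_approx hφ_cont hφ_poly hX hf hε.1
  have hpos : ∀ v, 0 < μ (U v) := fun v =>
    Measure.mem_support_iff_forall v |>.1 (hμ_supp ▸ Set.mem_univ v) _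
      ((hU v).1.mem_nhds (hU v).2)
  have hlt : ∀ v, μ (U v)ᶜ < 1 := fun v => by
    rw [prob_compl_eq_one_sub (hU v).1.measurableSet]
    exact ENNReal.sub_lt_self ENNReal.one_ne_top one_ne_zero (hpos v).ne'
  have hlim : Tendsto (fun n : ℕ => ∑ v ∈ s, μ (U v)ᶜ ^ n) atTop (𝓝 0) := by
    simpa using tendsto_finsetSum s fun v _ =>
      ENNReal.tendsto_pow_atTop_nhds_zero_of_lt_one (hlt v)
  obtain ⟨n, hn, hn1⟩ := ((hlim.eventually_lt_const
    (ENNReal.ofReal_pos.2 hδ.1)).and (eventually_ge_atTop 1)).exists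
  refine ⟨n, hn1, fun Ω _ P _ W hW => ?_⟩
  set B : Set Ω := ⋃ v ∈ s, ⋂ i ∈ Finset.range n, W i ⁻¹' (U v)ᶜ with hB
  have hPB : P B ≤ ENNReal.ofReal δ := by
    refine (measure_biUnion_finset_le s _).trans (le_trans (le_of_eq ?_) hn.le)
    exact Finset.sum_congr rfl fun v _ => measure_forall_lt_notMem hW (hU v).1.measurableSet n
  -- `HasLaw` makes each `W i` only a.e. measurable, so `B` is replaced by a measurable hull of
  -- equal measure.
  refine ⟨(toMeasurable P B)ᶜ, (measurableSet_toMeasurable P B).compl, ?_, fun z hz => ?_⟩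
  · rw [prob_compl_eq_one_sub (measurableSet_toMeasurable P B), measure_toMeasurable,
      ENNReal.ofReal_sub _ hδ.1.le, ENNReal.ofReal_one]
    exact tsub_le_tsub_left hPB _
  · have hzB : z ∉ B := fun h => hz (subset_toMeasurable P B h)
    have hex : ∀ v, ∃ i : Fin n, v ∈ s → W i z ∈ U v := by
      intro v
      by_cases hv : v ∈ s
      · simp only [hB, Set.mem_iUnion, Set.mem_iInter, Set.mem_preimage, Set.mem_compl_iff,
          not_exists, not_forall, not_not] at hzB
        obtain ⟨i, hi, hiU⟩ := hzB v hv
        exact ⟨⟨i, Finset.mem_range.1 hi⟩, fun _ => hiU⟩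
      -- A dummy index for `v ∉ s`, available because `1 ≤ n`.
      · exact ⟨⟨0, hn1⟩, fun h => absurd h hv⟩
    choose i hi using hex
    obtain ⟨a, ha⟩ := exists_readout (φ := φ) (s := s) c (fun j : Fin n => W j z) i
    refine ⟨a, fun x hx => ?_⟩
    rw [ha]
    exact happ (fun v => W (i v) z) (fun v hv => hi v hv) x hx
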